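/- **Definitions.** A Boolean algebra $B$ may be trivial ($0=1$ allowed). A *grill* of $B$ is a non-empty subset $\Gamma\subseteq B$ such that $0\notin\Gamma$; $a\in\Gamma$ and $a\le b$ imply $b\in\Gamma$; and $a\vee b\in\Gamma$ implies $a\in\Gamma$ or $b\in\Gamma$. An *ultrafilter* of $B$ is a maximal proper filter; every ultrafilter is a grill. For a topological space $X$, $RC(X)=\{F\subseteq X: F=\mathrm{cl}(\mathrm{int}\,F)\}$ is the Boolean algebra of regular closed sets, with $F\vee G=F\cup G$, $F\wedge G=\mathrm{cl}(\mathrm{int}(F\cap G))$, $F^*=\mathrm{cl}(X\setminus F)$, $0=\emptyset$, $1=X$. For a dense subspace $X_0$ of $X$, with $CO(X_0)$ the Boolean algebra of clopen subsets of $X_0$, let $RC(X,X_0)=\{\mathrm{cl}_X(A): A\in CO(X_0)\}$; this is a Boolean subalgebra of $RC(X)$. A family of closed subsets of $X$ is a *closed base* if every closed set is an intersection of members of the family. A *Stone 2-space* is a pair $(X,X_0)$ where $X$ is a (possibly empty) $T_0$-space, $X_0$ is a dense subspace of $X$ that is a Stone space (compact, Hausdorff, totally disconnected), $RC(X,X_0)$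 is a closed base of $X$, and for every grill $\Gamma$ of $CO(X_0)$ there is a point $x\in X$ with $\Gamma=\{F\in CO(X_0): x\in \mathrm{cl}_X(F)\}$. Two Stone 2-spaces $(X,X_0)$, $(Y,Y_0)$ are *isomorphic* if there is a homeomorphism $f:X\to Y$ with $f(X_0)=Y_0$. For a Boolean algebra $B$, let $\mathbf X^s(B)=(X,X_0)$, where $X$ is the set of all grills of $B$ with the topology having $\{g_B(a): a\in B\}$ as a closed base, $g_B(a)=\{\Gamma\in X: a\in\Gamma\}$, and $X_0\subseteq X$ is the set of all ultrafilters of $B$ with the subspace topology. **Theorem** (a connected version of the Stone Representation Theorem). For every Boolean algebra $B$, $\mathbf X^s(B)$ is a Stone 2-space (the *canonical Stone 2-space* of $B$). Moreover: (a) Let $B$ be a Boolean algebra and $(X,X_0)=\mathbf X^s(B)$. Then $g_B$ is a Boolean isomorphism from $B$ onto the Boolean algebra $RC(X,X_0)$. The sets $RC(X,X_0)$ and $RC(X)$ coincide if and only if $B$ is complete. (b) There is a bijective correspondence between the class of all Boolean algebras up to Boolean isomorphism and the class of all Stone 2-spaces up to isomorphism: the assignments $[B]\mapsto[\mathbf X^s(B)]$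 and $[(X,X_0)]\mapsto[RC(X,X_0)]$ are well defined and mutually inverse. -/

import Mathlib

universe u

namespace ConnectedStone

open TopologicalSpace

/-! ### Boolean algebras: isomorphisms, filters, ultrafilters, grills -/

/-- A Boolean isomorphism: a bijection that preserves all Boolean operations. -/
structure IsBooleanIso {A B : Type*} [BooleanAlgebra A] [BooleanAlgebra B] (f : A → B) : Prop where
  bijective : Function.Bijective f
  map_sup : ∀ a b, f (a ⊔ b) = f a ⊔ f b
  map_inf : ∀ a b, f (a ⊓ b) = f a ⊓ f b
  map_compl : ∀ a, f aᶜ = (f a)ᶜ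
  map_bot : f ⊥ = ⊥
  map_top : f ⊤ = ⊤

/-- A proper filter of a Boolean algebra. -/
structure IsProperFilter {B : Type*} [BooleanAlgebra B] (F : Set B) : Prop where
  nonempty : F.Nonempty
  upward : ∀ a b, a ∈ F → a ≤ b → b ∈ F
  inf_mem : ∀ a b, a ∈ F → b ∈ F → a ⊓ b ∈ F
  bot_notMem : ⊥ ∉ F

/-- An ultrafilter of a Boolean algebra: a maximal proper filter. -/
def IsUltrafilter {B : Type*} [BooleanAlgebra B] (U : Set B) : Prop :=
  Maximal IsProperFilter U

/-- A grill of a Boolean algebra. -/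
structure IsGrill {B : Type*} [BooleanAlgebra B] (Γ : Set B) : Prop where
  nonempty : Γ.Nonempty
  bot_notMem : ⊥ ∉ Γ
  upward : ∀ a b, a ∈ Γ → a ≤ b → b ∈ Γ
  prime : ∀ a b, a ⊔ b ∈ Γ → a ∈ Γ ∨ b ∈ Γ

theorem IsUltrafilter.isGrill {B : Type*} [BooleanAlgebra B] {U : Set B} (hU : IsUltrafilter U) :
    IsGrill U := by
  have hF := hU.prop
  have key : ∀ a, (∀ x ∈ U, x ⊓ a ≠ ⊥) → a ∈ U := by
    intro a ha
    have hG : IsProperFilter {y : B | ∃ x ∈ U, x ⊓ a ≤ y} := by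
      refine ⟨?_, ?_, ?_, ?_⟩
      · obtain ⟨x, hx⟩ := hF.nonempty
        exact ⟨x, x, hx, inf_le_left⟩
      · rintro y z ⟨x, hx, hxy⟩ hyz
        exact ⟨x, hx, hxy.trans hyz⟩
      · rintro y z ⟨x, hx, hxy⟩ ⟨x', hx', hxz⟩
        refine ⟨x ⊓ x', hF.inf_mem _ _ hx hx', le_inf ?_ ?_⟩
        · exact (inf_le_inf_right a inf_le_left).trans hxy
        · exact (inf_le_inf_right a inf_le_right).trans hxz
      · rintro ⟨x, hx, hx'⟩
        exact ha x hx (le_bot_iff.mp hx')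
    obtain ⟨x, hx⟩ := hF.nonempty
    exact hU.le_of_ge hG (fun y hy => ⟨y, hy, inf_le_left⟩) ⟨x, hx, inf_le_right⟩
  refine ⟨hF.nonempty, hF.bot_notMem, hF.upward, ?_⟩
  intro a b hab
  by_contra h
  push Not at h
  obtain ⟨ha, hb⟩ := h
  have h1 : ∃ x ∈ U, x ⊓ a = ⊥ := by
    by_contra h; push Not at h; exact ha (key a h)
  have h2 : ∃ x ∈ U, x ⊓ b = ⊥ := by
    by_contra h; push Not at h; exact hb (key b h)
  obtain ⟨x, hx, hxa⟩ := h1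
  obtain ⟨y, hy, hyb⟩ := h2
  have hm := hF.inf_mem _ _ (hF.inf_mem _ _ hx hy) hab
  have e : x ⊓ y ⊓ (a ⊔ b) = ⊥ := by
    rw [← le_bot_iff, inf_sup_left]
    refine sup_le ?_ ?_
    · exact (inf_le_inf_right a inf_le_left).trans hxa.le
    · exact (inf_le_inf_right b inf_le_right).trans hyb.le
  rw [e] at hm
  exact hF.bot_notMem hm

/-- A Boolean algebra is complete if every subset has a least upper bound. -/
def IsCompleteAlg (B : Type*) [BooleanAlgebra B] : Prop :=
  ∀ S : Set B, ∃ s : B, IsLUB S s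

/-! ### Closed bases -/

/-- A closed base: a family of closed sets such that every closed set is an intersection of
members of the family (the empty intersection is the whole space). -/
def IsClosedBase {X : Type*} [TopologicalSpace X] (𝓑 : Set (Set X)) : Prop :=
  (∀ F ∈ 𝓑, IsClosed F) ∧ ∀ C : Set X, IsClosed C → ∃ 𝓢 ⊆ 𝓑, C = ⋂₀ 𝓢

/-! ### The Boolean algebra of regular closed sets -/

/-- The set `RC(X)` of all regular closed subsets of `X`. -/
def regularClosedSets (X : Type*) [TopologicalSpace X] : Set (Set X) :=
  {F | closure (interior F) = F}

/-- `RC(X)` as a type. -/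
def RC (X : Type*) [TopologicalSpace X] : Type _ := {F : Set X // F ∈ regularClosedSets X}

section RCAlgebra

variable {X : Type*} [TopologicalSpace X]

theorem closure_mem_regularClosedSets {U : Set X} (hU : IsOpen U) :
    closure U ∈ regularClosedSets X := by
  apply subset_antisymm
  · exact closure_minimal interior_subset isClosed_closure
  · exact closure_mono (interior_maximal subset_closure hU)

theorem isClosed_of_mem_regularClosedSets {F : Set X} (hF : F ∈ regularClosedSets X) :
    IsClosed F := by
  have h : closure (interior F) = F := hF
  rw [← h]
  exact isClosed_closure

theorem union_mem_regularClosedSets {F G : Set X} (hF : F ∈ regularClosedSets X)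
    (hG : G ∈ regularClosedSets X) : F ∪ G ∈ regularClosedSets X := by
  have hF' : closure (interior F) = F := hF
  have hG' : closure (interior G) = G := hG
  have h := closure_mem_regularClosedSets ((isOpen_interior (s := F)).union (isOpen_interior (s := G)))
  rwa [closure_union, hF', hG'] at h

/-- The Boolean algebra `RC(X)`: the order is inclusion, `F ⊔ G = F ∪ G`,
`F ⊓ G = cl (int (F ∩ G))`, `Fᶜ = cl (X \ F)`, `⊥ = ∅`, `⊤ = X`. -/
instance instBooleanAlgebraRC : BooleanAlgebra (RC X) where
  le F G := F.1 ⊆ G.1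
  le_refl F := subset_rfl
  le_trans F G H h h' := Set.Subset.trans h h'
  le_antisymm F G h h' := Subtype.ext (subset_antisymm h h')
  sup F G := ⟨F.1 ∪ G.1, union_mem_regularClosedSets F.2 G.2⟩
  le_sup_left F G := Set.subset_union_left
  le_sup_right F G := Set.subset_union_right
  sup_le F G H h h' := Set.union_subset h h'
  inf F G := ⟨closure (interior (F.1 ∩ G.1)), closure_mem_regularClosedSets isOpen_interior⟩
  inf_le_left F G := closure_minimal (interior_subset.trans Set.inter_subset_left)
    (isClosed_of_mem_regularClosedSets F.2)
  inf_le_right F G := closure_minimal (interior_subset.trans Set.inter_subset_right)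
    (isClosed_of_mem_regularClosedSets G.2)
  le_inf F G H h h' := by
    have e : closure (interior F.1) = F.1 := F.2
    change F.1 ⊆ closure (interior (G.1 ∩ H.1))
    calc F.1 = closure (interior F.1) := e.symm
      _ ⊆ _ := closure_mono (interior_mono (Set.subset_inter h h'))
  top := ⟨Set.univ, by simp [regularClosedSets]⟩
  bot := ⟨∅, by simp [regularClosedSets]⟩
  le_top F := Set.subset_univ _
  bot_le F := Set.empty_subset _
  compl F := ⟨closure F.1ᶜ,
    closure_mem_regularClosedSets (isClosed_of_mem_regularClosedSets F.2).isOpen_compl⟩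
  le_sup_inf F G H := by
    change closure (interior ((F.1 ∪ G.1) ∩ (F.1 ∪ H.1))) ⊆ F.1 ∪ closure (interior (G.1 ∩ H.1))
    refine closure_minimal ?_ ((isClosed_of_mem_regularClosedSets F.2).union isClosed_closure)
    intro p hp
    by_cases hpF : p ∈ F.1
    · exact Or.inl hpF
    · right
      apply subset_closure
      have ho : IsOpen (interior ((F.1 ∪ G.1) ∩ (F.1 ∪ H.1)) ∩ F.1ᶜ) :=
        isOpen_interior.inter (isClosed_of_mem_regularClosedSets F.2).isOpen_compl
      refine interior_maximal ?_ ho ⟨hp, hpF⟩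
      rintro q ⟨hq, hqF⟩
      have hq' := interior_subset hq
      exact ⟨hq'.1.resolve_left hqF, hq'.2.resolve_left hqF⟩
  inf_compl_le_bot F := by
    change closure (interior (F.1 ∩ closure F.1ᶜ)) ⊆ ∅
    have e : interior (F.1 ∩ closure F.1ᶜ) = ∅ := by
      rw [closure_compl, interior_inter, Set.eq_empty_iff_forall_notMem]
      rintro p ⟨hp, hp'⟩
      exact interior_subset hp' hp
    rw [e, closure_empty]
  top_le_sup_compl F := by
    intro p _
    by_cases hp : p ∈ F.1
    · exact Or.inl hp
    · exact Or.inr (subset_closure hp)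

end RCAlgebra

/-! ### Topological pairs -/

section Pair

variable {X : Type*} [TopologicalSpace X]

/-- The set `RC(X, X₀)` of the closures in `X` of the clopen subsets of the subspace `X₀`. -/
def pairRC (X₀ : Set X) : Set (Set X) :=
  {F | ∃ A : Set X₀, IsClopen A ∧ closure (Subtype.val '' A) = F}

theorem closure_compl_closure_image {X₀ : Set X} (h : Dense X₀) {A : Set X₀} (hA : IsClopen A) :
    closure (closure (Subtype.val '' A))ᶜ = closure (Subtype.val '' Aᶜ) := by
  apply subset_antisymm
  · refine closure_minimal ?_ isClosed_closure
    refine (h.open_subset_closure_inter isClosed_closure.isOpen_compl).trans (closure_mono ?_)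
    rintro x ⟨hx, hx₀⟩
    exact ⟨⟨x, hx₀⟩, fun hxA => hx (subset_closure ⟨_, hxA, rfl⟩), rfl⟩
  · apply closure_mono
    rintro _ ⟨x, hx, rfl⟩ hx'
    apply hx
    rw [← hA.isClosed.closure_eq,
      Topology.IsInducing.subtypeVal.closure_eq_preimage_closure_image]
    exact hx'

theorem pairRC_subset {X₀ : Set X} (h : Dense X₀) : pairRC X₀ ⊆ regularClosedSets X := by
  rintro _ ⟨A, hA, rfl⟩
  have e := closure_compl_closure_image h hA.compl
  rw [compl_compl] at e
  rw [← e]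
  exact closure_mem_regularClosedSets isClosed_closure.isOpen_compl

/-- `RC(X, X₀)` as a Boolean subalgebra of `RC(X)`, for a dense subspace `X₀` of `X`. -/
def pairAlgebra (X₀ : Set X) (h : Dense X₀) : BooleanSubalgebra (RC X) where
  carrier := {F | F.1 ∈ pairRC X₀}
  supClosed' := by
    rintro F ⟨A, hA, hF⟩ G ⟨A', hA', hG⟩
    refine ⟨A ∪ A', hA.union hA', ?_⟩
    rw [Set.image_union, closure_union, hF, hG]
    rfl
  infClosed' := by
    rintro F ⟨A, hA, hF⟩ G ⟨A', hA', hG⟩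
    have hc : ∀ (H : RC X) (D : Set X₀), IsClopen D → closure (Subtype.val '' D) = H.1 →
        closure (Subtype.val '' Dᶜ) = (Hᶜ).1 := by
      intro H D hD hH
      rw [← closure_compl_closure_image h hD, hH]
      rfl
    refine ⟨(Aᶜ ∪ A'ᶜ)ᶜ, (hA.compl.union hA'.compl).compl, ?_⟩
    have e : F ⊓ G = (Fᶜ ⊔ Gᶜ)ᶜ := by simp
    rw [e]
    refine hc _ _ (hA.compl.union hA'.compl) ?_
    rw [Set.image_union, closure_union, hc F A hA hF, hc G A' hA' hG]
    rfl
  compl_mem' := by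
    rintro F ⟨A, hA, hF⟩
    refine ⟨Aᶜ, hA.compl, ?_⟩
    rw [← closure_compl_closure_image h hA, hF]
    rfl
  bot_mem' := by
    refine ⟨∅, isClopen_empty, ?_⟩
    rw [Set.image_empty, closure_empty]
    rfl

/-- The set `Γ_{x, X₀}` of those clopen subsets of `X₀` whose closure in `X` contains `x`. -/
def pointGrill (X₀ : Set X) (x : X) : Set (Clopens X₀) :=
  {F | x ∈ closure (Subtype.val '' (F : Set X₀))}

end Pair

/-- `(X, X₀)` is a Stone 2-space. -/
structure IsStone2Space (X : Type*) [TopologicalSpace X] (X₀ : Set X) : Prop where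
  /-- `(X, X₀)` is a topological pair -/
  dense : Dense X₀
  t0 : T0Space X
  /-- the subspace `X₀` is a Stone space -/
  compact_core : CompactSpace X₀
  t2_core : T2Space X₀
  totallyDisconnected_core : TotallyDisconnectedSpace X₀
  closedBase : IsClosedBase (pairRC X₀)
  grill_eq : ∀ Γ : Set (Clopens X₀), IsGrill Γ → ∃ x : X, Γ = pointGrill X₀ x

/-! ### The canonical Stone 2-space of a Boolean algebra -/

section Canonical

variable (B : Type*) [BooleanAlgebra B]

/-- The set of all grills of `B`. -/
def Grills : Type _ := {Γ : Set B // IsGrill Γ}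

variable {B} in
/-- `g_B(a)` is the set of all grills that contain `a`. -/
def gMap (a : B) : Set (Grills B) := {Γ | a ∈ Γ.1}

/-- The topology on `Grills B` whose closed base is the family of all `g_B(a)`. -/
instance instTopologicalSpaceGrills : TopologicalSpace (Grills B) :=
  generateFrom (Set.range fun a : B => (gMap a)ᶜ)

/-- The set of all ultrafilters of `B`, as a subset of the set of all grills (every ultrafilter is a
grill, by `IsUltrafilter.isGrill`). -/
def Ult : Set (Grills B) := {Γ | IsUltrafilter Γ.1}

theorem isClosedBase_gMap : IsClosedBase (Set.range (gMap (B := B))) := by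
  have hb : IsTopologicalBasis (Set.range fun a : B => (gMap a)ᶜ) := by
    refine ⟨?_, ?_, rfl⟩
    · rintro _ ⟨a, rfl⟩ _ ⟨b, rfl⟩ Γ ⟨ha, hb⟩
      refine ⟨_, ⟨a ⊔ b, rfl⟩, fun h => (Γ.2.prime a b h).elim ha hb, ?_⟩
      intro Δ hΔ
      exact ⟨fun h => hΔ (Δ.2.upward _ _ h le_sup_left),
        fun h => hΔ (Δ.2.upward _ _ h le_sup_right)⟩
    · refine Set.eq_univ_of_forall fun Γ => ⟨_, ⟨⊥, rfl⟩, Γ.2.bot_notMem⟩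
  refine ⟨?_, ?_⟩
  · rintro _ ⟨a, rfl⟩
    exact isOpen_compl_iff.mp (isOpen_generateFrom_of_mem ⟨a, rfl⟩)
  · intro C hC
    refine ⟨{F | F ∈ Set.range (gMap (B := B)) ∧ C ⊆ F}, fun F hF => hF.1, ?_⟩
    apply subset_antisymm
    · exact fun x hx F hF => hF.2 hx
    · intro x hx
      by_contra hxC
      obtain ⟨_, ⟨a, rfl⟩, hxa, haC⟩ := hb.exists_subset_of_mem_open hxC hC.isOpen_compl
      exact hxa (hx _ ⟨⟨a, rfl⟩, fun y hy => by_contra fun h => haC h hy⟩)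

end Canonical

/-! ### Isomorphism classes -/

/-- Two Boolean algebras are equivalent if there is a Boolean isomorphism between them. -/
def boolAlgSetoid : Setoid BoolAlg.{u} where
  r A B := ∃ f : A → B, IsBooleanIso f
  iseqv := by
    refine ⟨fun A => ⟨id, Function.bijective_id, fun _ _ => rfl, fun _ _ => rfl, fun _ => rfl,
      rfl, rfl⟩, ?_, ?_⟩
    · rintro A B ⟨f, hf⟩
      obtain ⟨g, hg, hg'⟩ := Function.bijective_iff_has_inverse.mp hf.bijective
      refine ⟨g, Function.bijective_iff_has_inverse.mpr ⟨f, hg', hg⟩, ?_, ?_, ?_, ?_, ?_⟩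
      · intro a b; apply hf.bijective.1; rw [hf.map_sup, hg', hg', hg']
      · intro a b; apply hf.bijective.1; rw [hf.map_inf, hg', hg', hg']
      · intro a; apply hf.bijective.1; rw [hf.map_compl, hg', hg']
      · apply hf.bijective.1; rw [hf.map_bot, hg']
      · apply hf.bijective.1; rw [hf.map_top, hg']
    · rintro A B C ⟨f, hf⟩ ⟨g, hg⟩
      refine ⟨g ∘ f, hg.bijective.comp hf.bijective, ?_, ?_, ?_, ?_, ?_⟩
      · intro a b; simp [hf.map_sup, hg.map_sup]
      · intro a b; simp [hf.map_inf, hg.map_inf]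
      · intro a; simp [hf.map_compl, hg.map_compl]
      · simp [hf.map_bot, hg.map_bot]
      · simp [hf.map_top, hg.map_top]

/-- A Stone 2-space, as a bundled object. -/
structure Stone2Space : Type (u + 1) where
  /-- the space `X` -/
  carrier : Type u
  [top : TopologicalSpace carrier]
  /-- the dense subspace `X₀` -/
  core : Set carrier
  isStone2Space : IsStone2Space carrier core

attribute [instance] Stone2Space.top

/-- Two Stone 2-spaces are equivalent if there is a homeomorphism `f` with `f(X₀) = Y₀`. -/
def stone2SpaceSetoid : Setoid Stone2Space.{u} where
  r S T := ∃ f : S.carrier ≃ₜ T.carrier, f '' S.core = T.core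
  iseqv := by
    refine ⟨fun S => ⟨Homeomorph.refl _, by simp⟩, ?_, ?_⟩
    · rintro S T ⟨f, hf⟩
      exact ⟨f.symm, by rw [← hf, ← Set.image_comp]; simp⟩
    · rintro S T U ⟨f, hf⟩ ⟨g, hg⟩
      exact ⟨f.trans g, by rw [← hg, ← hf, ← Set.image_comp]; rfl⟩

/-- The canonical Boolean algebra `RC(X, X₀)` of a Stone 2-space `(X, X₀)`. -/
def Stone2Space.algebra (S : Stone2Space.{u}) : BoolAlg.{u} :=
  BoolAlg.of (pairAlgebra S.core S.isStone2Space.dense)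

end ConnectedStone

/-!
The whole theorem rests on one form of the Boolean prime ideal theorem
(`IsGrill.exists_isUltrafilter_subset`): every member `a` of a grill `Γ` lies in an ultrafilter
contained in `Γ`, i.e. a grill is the union of the ultrafilters below it.

Since a basic neighbourhood of `Γ` is given by an element `b ∉ Γ`, and hence contains every grill
below `Γ`, this says that `g_B(a)` is the closure of the set `s(a)` of ultrafilters containing `a`
(`closure_stoneClopens`), and also the closure of the complement of `g_B(aᶜ)`
(`gMap_subset_closure_compl_gMap_compl`). By the classical Stone duality argument, `Ult B` is a Stone
space whose clopen sets are exactly the `s(a)`; so `RC(Grills B, Ult B)` is the range of `g_B`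
(`pairRC_Ult`), and `g_B` is an order isomorphism onto it. The remaining axioms of a Stone 2-space
follow. Regular closed sets are closed under the suprema `cl (⋃ int F)`, which gives completeness of
`B` when all of them are of the form `g_B(a)`. If conversely `B` is complete, a regular closed set
`F` equals `g_B(s)` with `s` the supremum of all `d` such that `g_B(d) ⊆ F`
(`pairRC_Ult_eq_regularClosedSets_iff`).

For the correspondence, let `(X, X₀)` be a Stone 2-space and `e` an order isomorphism of a Boolean
algebra `A` onto `RC(X, X₀)`. Then `x ↦ {a | x ∈ e a}` is a homeomorphism of `X` onto `Grills A` that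
carries `X₀` onto `Ult A` (`IsStone2Space.exists_homeomorph_grills`): it is injective and inducing
because `RC(X, X₀)` is a closed base of a `T₀`-space, surjective by the grill axiom, and compactness
of `X₀` shows that a point whose trace is an ultrafilter lies in `X₀`. This yields both that
isomorphic Boolean algebras have isomorphic canonical spaces and that a Stone 2-space is isomorphic
to the canonical space of its algebra.
-/

namespace ConnectedStone

open TopologicalSpace

/-! ### Boolean isomorphisms as order isomorphisms -/

theorem isBooleanIso_orderIso {A B : Type*} [BooleanAlgebra A] [BooleanAlgebra B] (e : A ≃o B) :
    IsBooleanIso e :=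
  ⟨e.bijective, map_sup e, map_inf e, map_compl' e, map_bot e, map_top e⟩

theorem IsBooleanIso.exists_orderIso {A B : Type*} [BooleanAlgebra A] [BooleanAlgebra B]
    {f : A → B} (hf : IsBooleanIso f) : Nonempty (A ≃o B) := by
  refine ⟨⟨Equiv.ofBijective f hf.bijective, ?_⟩⟩
  intro a b
  change f a ≤ f b ↔ a ≤ b
  rw [← sup_eq_right, ← hf.map_sup, hf.bijective.1.eq_iff, sup_eq_right]

/-! ### Grills and ultrafilters -/

section Grill

variable {B : Type*} [BooleanAlgebra B]

theorem IsUltrafilter.compl_notMem {U : Set B} (hU : IsUltrafilter U) {a : B} (ha : a ∈ U) :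
    aᶜ ∉ U := fun ha' => by
  have := hU.prop.inf_mem _ _ ha ha'
  rw [inf_compl_self] at this
  exact hU.prop.bot_notMem this

theorem IsGrill.top_mem {Γ : Set B} (hΓ : IsGrill Γ) : ⊤ ∈ Γ :=
  let ⟨a, ha⟩ := hΓ.nonempty
  hΓ.upward a ⊤ ha le_top

theorem IsGrill.mem_or_compl_mem {Γ : Set B} (hΓ : IsGrill Γ) (a : B) : a ∈ Γ ∨ aᶜ ∈ Γ :=
  hΓ.prime a aᶜ (by rw [sup_compl_eq_top]; exact hΓ.top_mem)

/-- The ultrafilters are exactly the grills that contain no pair of complementary elements. -/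
theorem IsGrill.isUltrafilter {Γ : Set B} (hΓ : IsGrill Γ) (h : ∀ a ∈ Γ, aᶜ ∉ Γ) :
    IsUltrafilter Γ := by
  refine ⟨⟨hΓ.nonempty, hΓ.upward, ?_, hΓ.bot_notMem⟩, ?_⟩
  · intro a b ha hb
    refine (hΓ.mem_or_compl_mem (a ⊓ b)).resolve_right fun hc => ?_
    rw [compl_inf] at hc
    exact (hΓ.prime _ _ hc).elim (h a ha) (h b hb)
  · intro G hG hle a ha
    refine (hΓ.mem_or_compl_mem a).resolve_right fun hc => ?_
    have := hG.inf_mem _ _ ha (hle hc)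
    rw [inf_compl_self] at this
    exact hG.bot_notMem this

/-- A grill is the union of the ultrafilters that it contains. The complement of a grill is an
ideal, so this is the Boolean prime ideal theorem. -/
theorem IsGrill.exists_isUltrafilter_subset {Γ : Set B} (hΓ : IsGrill Γ) {a : B} (ha : a ∈ Γ) :
    ∃ U, IsUltrafilter U ∧ a ∈ U ∧ U ⊆ Γ := by
  let I : Order.Ideal B :=
    { carrier := Γᶜ
      lower' := fun b c hcb hb hc => hb (hΓ.upward _ _ hc hcb)
      nonempty' := ⟨⊥, hΓ.bot_notMem⟩
      directed' := fun b hb c hc =>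
        ⟨b ⊔ c, fun h => (hΓ.prime _ _ h).elim hb hc, le_sup_left, le_sup_right⟩ }
  have hd : Disjoint (Order.PFilter.principal a : Set B) (I : Set B) := by
    rw [Set.disjoint_left]
    intro b hb hbI
    exact hbI (hΓ.upward _ _ ha hb)
  obtain ⟨J, hJ, hIJ, hFJ⟩ := DistribLattice.prime_ideal_of_disjoint_filter_ideal hd
  have haJ : a ∉ J := fun h => Set.disjoint_left.mp hFJ (Order.PFilter.mem_principal.mpr le_rfl) h
  refine ⟨(J : Set B)ᶜ, IsGrill.isUltrafilter ⟨⟨a, haJ⟩, fun h => h J.bot_mem, ?_, ?_⟩ ?_, haJ, ?_⟩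
  · exact fun b c hb hbc hc => hb (J.lower hbc hc)
  · intro b c hbc
    by_contra! h
    exact hbc (J.sup_mem (not_not.mp h.1) (not_not.mp h.2))
  · intro b hb hb'
    exact (hJ.mem_or_mem (x := b) (y := bᶜ) (by rw [inf_compl_self]; exact J.bot_mem)).elim hb hb'
  · intro b hb
    by_contra hbΓ
    exact hb (hIJ hbΓ)

theorem isGrill_setOf_ne_bot [Nontrivial B] : IsGrill {b : B | b ≠ ⊥} := by
  refine ⟨⟨⊤, top_ne_bot⟩, fun h => h rfl, fun b c hb hbc hc => hb ?_, fun b c hbc => ?_⟩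
  · exact le_bot_iff.mp (hc ▸ hbc)
  · by_contra! h
    simp only [Set.mem_ofPred_eq, not_not] at h
    exact hbc (by rw [h.1, h.2, sup_bot_eq])

theorem exists_isUltrafilter_mem {a : B} (ha : a ≠ ⊥) : ∃ U, IsUltrafilter U ∧ a ∈ U := by
  have : Nontrivial B := ⟨a, ⊥, ha⟩
  obtain ⟨U, hU, haU, -⟩ := isGrill_setOf_ne_bot.exists_isUltrafilter_subset (a := a) ha
  exact ⟨U, hU, haU⟩

end Grill

/-! ### The topology of the space of grills -/

section Canonical

variable {B : Type*} [BooleanAlgebra B]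

theorem isClosed_gMap (a : B) : IsClosed (gMap a) := isClosedBase_gMap B |>.1 _ ⟨a, rfl⟩

theorem IsClosedBase.mem_closure {X : Type*} [TopologicalSpace X] {𝓑 : Set (Set X)}
    (h : IsClosedBase 𝓑) {S : Set X} {x : X} (hx : ∀ F ∈ 𝓑, S ⊆ F → x ∈ F) : x ∈ closure S := by
  obtain ⟨𝓢, h𝓢, he⟩ := h.2 _ (isClosed_closure (s := S))
  rw [he]
  intro F hF
  refine hx F (h𝓢 hF) (subset_closure.trans ?_)
  rw [he]
  exact Set.sInter_subset_of_mem hF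

theorem mem_closure_grills {S : Set (Grills B)} {Γ : Grills B}
    (h : ∀ b : B, S ⊆ gMap b → b ∈ Γ.1) : Γ ∈ closure S := by
  apply (isClosedBase_gMap B).mem_closure
  rintro _ ⟨b, rfl⟩ hb
  exact h b hb

/-- Closed sets of grills are upward closed for inclusion, since the basic ones `gMap b` are. -/
theorem mem_closure_of_subset {S : Set (Grills B)} {Δ Γ : Grills B} (hΔ : Δ ∈ S)
    (h : Δ.1 ⊆ Γ.1) : Γ ∈ closure S :=
  mem_closure_grills fun _ hb => h (hb hΔ)

theorem gMap_subset_closure_compl_gMap_compl (a : B) : gMap a ⊆ closure (gMap aᶜ)ᶜ := by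
  intro Γ hΓ
  obtain ⟨U, hU, haU, hUΓ⟩ := Γ.2.exists_isUltrafilter_subset hΓ
  exact mem_closure_of_subset (Δ := ⟨U, hU.isGrill⟩) (hU.compl_notMem haU) hUΓ

theorem gMap_subset_gMap_iff {a b : B} : gMap a ⊆ gMap b ↔ a ≤ b := by
  refine ⟨fun h => ?_, fun h Γ hΓ => Γ.2.upward _ _ hΓ h⟩
  by_contra hab
  have hne : a ⊓ bᶜ ≠ ⊥ := fun h => hab (by rwa [← sdiff_eq, sdiff_eq_bot_iff] at h)
  obtain ⟨U, hU, hm⟩ := exists_isUltrafilter_mem hne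
  have hb : b ∈ U := h (a := ⟨U, hU.isGrill⟩) (hU.prop.upward _ _ hm inf_le_left)
  exact hU.compl_notMem hb (hU.prop.upward _ _ hm inf_le_right)

theorem isClopen_preimage_gMap (a : B) :
    IsClopen ((Subtype.val : Ult B → Grills B) ⁻¹' gMap a) := by
  refine ⟨(isClosed_gMap a).preimage continuous_subtype_val, ?_⟩
  have : (Subtype.val : Ult B → Grills B) ⁻¹' gMap a = (Subtype.val ⁻¹' gMap aᶜ)ᶜ := by
    ext U
    refine ⟨fun h => U.2.compl_notMem h, fun h => ?_⟩
    exact (U.1.2.mem_or_compl_mem a).resolve_right h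
  rw [this]
  exact ((isClosed_gMap aᶜ).preimage continuous_subtype_val).isOpen_compl

/-- The Stone map: the clopen set of all ultrafilters that contain `a`. -/
def stoneClopens (a : B) : Clopens (Ult B) := ⟨Subtype.val ⁻¹' gMap a, isClopen_preimage_gMap a⟩

theorem closure_stoneClopens (a : B) :
    closure (Subtype.val '' (stoneClopens a : Set (Ult B))) = gMap a := by
  apply subset_antisymm
  · refine closure_minimal ?_ (isClosed_gMap a)
    rintro _ ⟨U, hU, rfl⟩
    exact hU
  · intro Γ hΓ
    obtain ⟨U, hU, haU, hUΓ⟩ := Γ.2.exists_isUltrafilter_subset hΓ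
    exact mem_closure_of_subset (Δ := ⟨U, hU.isGrill⟩) ⟨⟨⟨U, hU.isGrill⟩, hU⟩, haU, rfl⟩ hUΓ

theorem dense_Ult : Dense (Ult B) := by
  intro Γ
  have h : Γ ∈ gMap (⊤ : B) := Γ.2.top_mem
  rw [← closure_stoneClopens] at h
  exact closure_mono (Subtype.coe_image_subset _ _) h

theorem stoneClopens_sup (a b : B) : stoneClopens (a ⊔ b) = stoneClopens a ⊔ stoneClopens b := by
  ext U
  refine ⟨U.1.2.prime a b, fun h => ?_⟩
  rcases h with h | h
  · exact U.1.2.upward _ _ h le_sup_left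
  · exact U.1.2.upward _ _ h le_sup_right

theorem stoneClopens_bot : stoneClopens (⊥ : B) = ⊥ := by
  ext U
  exact ⟨fun h => U.1.2.bot_notMem h, fun h => h.elim⟩

theorem stoneClopens_mono {a b : B} (h : a ≤ b) : stoneClopens a ≤ stoneClopens b :=
  fun U hU => U.1.2.upward _ _ hU h

instance : TotallySeparatedSpace (Ult B) := by
  rw [totallySeparatedSpace_iff_exists_isClopen]
  intro U V hUV
  -- by maximality, distinct ultrafilters are not comparable
  have : ¬ U.1.1 ⊆ V.1.1 := fun h =>
    hUV (Subtype.ext (Subtype.ext (subset_antisymm h (U.2.le_of_ge V.2.prop h))))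
  obtain ⟨a, haU, haV⟩ := Set.not_subset.mp this
  exact ⟨_, isClopen_preimage_gMap a, haU, haV⟩

/-- An ultrafilter `𝓕` of sets of ultrafilters converges to its trace `{a | s(a) ∈ 𝓕}`. -/
instance : CompactSpace (Ult B) := by
  refine ⟨isCompact_iff_ultrafilter_le_nhds.mpr fun 𝓕 _ => ?_⟩
  have hΓ : IsGrill {a : B | (stoneClopens a : Set (Ult B)) ∈ 𝓕} := by
    refine ⟨⟨⊤, Filter.mem_of_superset Filter.univ_mem fun U _ => U.1.2.top_mem⟩, ?_, ?_, ?_⟩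
    · intro h
      rw [Set.mem_ofPred_eq, stoneClopens_bot] at h
      exact 𝓕.empty_notMem h
    · exact fun a b ha hab => Filter.mem_of_superset ha (stoneClopens_mono hab)
    · intro a b h
      rw [Set.mem_ofPred_eq, stoneClopens_sup] at h
      exact Ultrafilter.union_mem_iff.mp h
  have hU : IsUltrafilter {a : B | (stoneClopens a : Set (Ult B)) ∈ 𝓕} := by
    refine hΓ.isUltrafilter fun a ha ha' => ?_
    obtain ⟨U, hU, hU'⟩ := 𝓕.nonempty_of_mem (Filter.inter_mem ha ha')
    exact U.2.compl_notMem hU hU'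
  let Δ : Grills B := ⟨_, hΓ⟩
  have hΔ : Δ ∈ Ult B := hU
  refine ⟨⟨Δ, hΔ⟩, Set.mem_univ _, ?_⟩
  rw [nhds_subtype_eq_comap, ← Filter.map_le_iff_le_comap]
  change _ ≤ @nhds _ (generateFrom _) _
  rw [nhds_generateFrom]
  refine le_iInf₂ ?_
  rintro _ ⟨ha, ⟨a, rfl⟩⟩
  rw [Filter.le_principal_iff]
  exact Ultrafilter.compl_mem_iff_notMem.mpr ha

/-- By compactness, every clopen set of ultrafilters is in the range of the Stone map. -/
theorem exists_stoneClopens_eq (A : Clopens (Ult B)) : ∃ a : B, stoneClopens a = A := by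
  let t : {a : B // stoneClopens a ≤ A} → Set (Ult B) := fun a => stoneClopens a.1
  have hne : Nonempty {a : B // stoneClopens a ≤ A} :=
    ⟨⟨⊥, by rw [stoneClopens_bot]; exact bot_le⟩⟩
  have hcov : (A : Set (Ult B)) ⊆ ⋃ a, t a := by
    intro U hU
    by_contra hcon
    have hcl : U.1 ∈ closure (Subtype.val '' (A : Set (Ult B))ᶜ) := by
      refine mem_closure_grills fun b hb => by_contra fun hbU => ?_
      refine hcon (Set.mem_iUnion.mpr ⟨⟨bᶜ, fun V hV => ?_⟩,
        (U.1.2.mem_or_compl_mem b).resolve_left hbU⟩)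
      by_contra hVA
      exact V.2.compl_notMem (hb ⟨V, hVA, rfl⟩) hV
    have : U ∈ closure (A : Set (Ult B))ᶜ := by
      rw [Topology.IsInducing.subtypeVal.closure_eq_preimage_closure_image]
      exact hcl
    rw [A.isClopen.compl.isClosed.closure_eq] at this
    exact this hU
  have hdir : Directed (· ⊆ ·) t := by
    rintro ⟨a, ha⟩ ⟨b, hb⟩
    exact ⟨⟨a ⊔ b, by rw [stoneClopens_sup]; exact sup_le ha hb⟩,
      stoneClopens_mono le_sup_left, stoneClopens_mono le_sup_right⟩
  obtain ⟨⟨a, haA⟩, ha⟩ := A.isClopen.isClosed.isCompact.elim_directed_cover t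
    (fun a => (stoneClopens a.1).isClopen.isOpen) hcov hdir
  exact ⟨a, le_antisymm haA ha⟩

variable (B) in
theorem pairRC_Ult : pairRC (Ult B) = Set.range (gMap (B := B)) := by
  ext F
  constructor
  · rintro ⟨A, hA, rfl⟩
    obtain ⟨a, ha⟩ := exists_stoneClopens_eq ⟨A, hA⟩
    exact ⟨a, by rw [← closure_stoneClopens, ha]; rfl⟩
  · rintro ⟨a, rfl⟩
    exact ⟨_, (stoneClopens a).isClopen, closure_stoneClopens a⟩

variable (B) in
theorem isStone2Space_grills : IsStone2Space (Grills B) (Ult B) where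
  dense := dense_Ult
  t0 := by
    refine ⟨fun Γ Δ h => Subtype.ext (Set.ext fun a => ?_)⟩
    exact h.mem_closed_iff (isClosed_gMap a)
  compact_core := inferInstance
  t2_core := inferInstance
  totallyDisconnected_core := inferInstance
  closedBase := by rw [pairRC_Ult]; exact isClosedBase_gMap B
  grill_eq := by
    intro Γ hΓ
    have h : IsGrill {a : B | stoneClopens a ∈ Γ} := by
      refine ⟨?_, ?_, ?_, ?_⟩
      · obtain ⟨a, ha⟩ := exists_stoneClopens_eq (⊤ : Clopens (Ult B))
        exact ⟨a, by rw [Set.mem_ofPred_eq, ha]; exact hΓ.top_mem⟩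
      · rw [Set.mem_ofPred_eq, stoneClopens_bot]
        exact hΓ.bot_notMem
      · exact fun a b ha hab => hΓ.upward _ _ ha (stoneClopens_mono hab)
      · intro a b hab
        rw [Set.mem_ofPred_eq, stoneClopens_sup] at hab
        exact hΓ.prime _ _ hab
    refine ⟨⟨_, h⟩, ?_⟩
    ext A
    obtain ⟨a, rfl⟩ := exists_stoneClopens_eq A
    change _ ↔ _ ∈ closure _
    rw [closure_stoneClopens]
    rfl

theorem gMap_mem_pairRC (a : B) : gMap a ∈ pairRC (Ult B) := by
  rw [pairRC_Ult]
  exact ⟨a, rfl⟩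

/-- `g_B` as an order isomorphism of `B` onto `RC(Grills B, Ult B)`. -/
noncomputable def gOrderIso (h : Dense (Ult B)) : B ≃o pairAlgebra (Ult B) h where
  toEquiv := Equiv.ofBijective
    (fun a => ⟨⟨gMap a, pairRC_subset h (gMap_mem_pairRC a)⟩, gMap_mem_pairRC a⟩) <| by
      constructor
      · intro a b hab
        have e : gMap a = gMap b := congrArg (fun F => F.1.1) hab
        exact le_antisymm (gMap_subset_gMap_iff.mp e.subset) (gMap_subset_gMap_iff.mp e.symm.subset)
      · rintro ⟨⟨F, hF⟩, hF'⟩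
        have hF'' : F ∈ pairRC (Ult B) := hF'
        rw [pairRC_Ult] at hF''
        obtain ⟨a, rfl⟩ := hF''
        exact ⟨a, rfl⟩
  map_rel_iff' := gMap_subset_gMap_iff

theorem gOrderIso_val (h : Dense (Ult B)) (a : B) : (gOrderIso h a).1.1 = gMap a := rfl

/-! ### Completeness -/

variable (B) in
theorem pairRC_Ult_eq_regularClosedSets_iff :
    pairRC (Ult B) = regularClosedSets (Grills B) ↔ IsCompleteAlg B := by
  constructor
  · intro h S
    have hW : closure (⋃ a ∈ S, interior (gMap a)) ∈ pairRC (Ult B) := by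
      rw [h]
      exact closure_mem_regularClosedSets (isOpen_biUnion fun _ _ => isOpen_interior)
    rw [pairRC_Ult] at hW
    obtain ⟨s, hs⟩ := hW
    refine ⟨s, fun a ha => ?_, fun b hb => ?_⟩
    · have hr : closure (interior (gMap a)) = gMap a := h.subset (gMap_mem_pairRC a)
      rw [← gMap_subset_gMap_iff, hs, ← hr]
      exact closure_mono (Set.subset_biUnion_of_mem (u := fun a => interior (gMap a)) ha)
    · rw [← gMap_subset_gMap_iff, hs]
      refine closure_minimal (Set.iUnion₂_subset fun a ha => ?_) (isClosed_gMap b)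
      exact interior_subset.trans (gMap_subset_gMap_iff.mpr (hb ha))
  · intro h
    refine (pairRC_subset dense_Ult).antisymm fun F hF => ?_
    have hr : closure (interior F) = F := hF
    have hFc := isClosed_of_mem_regularClosedSets hF
    obtain ⟨s, hs⟩ := h {d : B | gMap d ⊆ F}
    rw [pairRC_Ult]
    refine ⟨s, subset_antisymm ?_ ?_⟩
    · rw [← hFc.closure_eq]
      refine fun Γ hΓ => mem_closure_grills fun b hb => ?_
      refine Γ.2.upward _ _ hΓ (hs.2 fun d hd => ?_)
      exact gMap_subset_gMap_iff.mp (Set.Subset.trans hd hb)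
    · rw [← hr]
      refine closure_minimal (fun Γ hΓ => ?_) (isClosed_gMap s)
      -- otherwise `Γ ∈ (gMap c)ᶜ ⊆ F` for some `c`, and then `gMap cᶜ ⊆ F` by taking closures
      by_contra hΓs
      have hcl : Γ ∈ closure (interior F)ᶜ := by
        refine mem_closure_grills fun c hc => by_contra fun hcΓ => ?_
        have hcF : gMap cᶜ ⊆ F := by
          refine (gMap_subset_closure_compl_gMap_compl cᶜ).trans (closure_minimal ?_ hFc)
          rw [compl_compl]
          exact (Set.compl_subset_comm.mp hc).trans interior_subset
        exact hΓs (Γ.2.upward _ _ ((Γ.2.mem_or_compl_mem c).resolve_left hcΓ) (hs.1 hcF))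
      rw [isOpen_interior.isClosed_compl.closure_eq] at hcl
      exact hcl hΓ

end Canonical

/-! ### Points of a Stone 2-space as grills -/

section Representation

variable {X : Type*} [TopologicalSpace X] {X₀ : Set X}

theorem mem_closure_image_val_iff {A : Set X₀} (hA : IsClosed A) (x : X₀) :
    x.1 ∈ closure (Subtype.val '' A) ↔ x ∈ A := by
  conv_rhs => rw [← hA.closure_eq,
    Topology.IsInducing.subtypeVal.closure_eq_preimage_closure_image]
  rfl

/-- A closed base determines the topology. -/
theorem IsClosedBase.eq_generateFrom {𝓑 : Set (Set X)} (h : IsClosedBase 𝓑) :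
    ‹TopologicalSpace X› = generateFrom (compl '' 𝓑) := by
  apply le_antisymm
  · rw [le_generateFrom_iff_subset_isOpen]
    rintro _ ⟨F, hF, rfl⟩
    exact (h.1 F hF).isOpen_compl
  · intro U hU
    obtain ⟨𝓢, h𝓢, he⟩ := h.2 Uᶜ hU.isClosed_compl
    rw [← compl_compl U, he, Set.compl_sInter]
    refine @isOpen_sUnion _ (generateFrom _) _ ?_
    rintro _ ⟨F, hF, rfl⟩
    exact isOpen_generateFrom_of_mem ⟨F, h𝓢 hF, rfl⟩

/-- Points of a `T₀`-space that lie in the same members of a closed base are equal. -/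
theorem IsClosedBase.eq_of_forall_mem_iff [T0Space X] {𝓑 : Set (Set X)} (h : IsClosedBase 𝓑)
    {x y : X} (hxy : ∀ F ∈ 𝓑, x ∈ F ↔ y ∈ F) : x = y := by
  refine Inseparable.eq (inseparable_iff_forall_isClosed.mpr fun C hC => ?_)
  obtain ⟨𝓢, h𝓢, rfl⟩ := h.2 C hC
  exact forall₂_congr fun F hF => hxy F (h𝓢 hF)

variable {A : Type*} [BooleanAlgebra A] {hd : Dense X₀} (e : A ≃o pairAlgebra X₀ hd)

theorem mem_orderIso_sup {x : X} {a b : A} :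
    x ∈ (e (a ⊔ b)).1.1 ↔ x ∈ (e a).1.1 ∨ x ∈ (e b).1.1 := by
  rw [map_sup]
  rfl

theorem notMem_orderIso_bot {x : X} : x ∉ (e ⊥).1.1 := by
  rw [map_bot]
  exact fun h => h

theorem mem_orderIso_top {x : X} : x ∈ (e ⊤).1.1 := by
  rw [map_top]
  exact trivial

/-- The grill of a point `x`: all elements whose associated regular closed set contains `x`. -/
def grillOfPoint (x : X) : Grills A :=
  ⟨{a | x ∈ (e a).1.1},
    ⟨⊤, mem_orderIso_top e⟩, notMem_orderIso_bot e,
    fun _ _ ha hab => (e.monotone hab : _) ha, fun _ _ h => (mem_orderIso_sup e).mp h⟩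

theorem mem_grillOfPoint {x : X} {a : A} : a ∈ (grillOfPoint e x).1 ↔ x ∈ (e a).1.1 := Iff.rfl

/-- On points of `X₀`, complements in `RC(X, X₀)` behave like complements of sets. -/
theorem notMem_orderIso_compl {x : X} (hx : x ∈ X₀) {a : A} (ha : x ∈ (e a).1.1) :
    x ∉ (e aᶜ).1.1 := by
  obtain ⟨D, hD, hDa⟩ := (e a).2
  have h : (e aᶜ).1.1 = closure (Subtype.val '' Dᶜ) := by
    rw [map_compl', ← closure_compl_closure_image hd hD, hDa]
    rfl
  rw [h, mem_closure_image_val_iff hD.compl.isClosed ⟨x, hx⟩]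
  rw [← hDa, mem_closure_image_val_iff hD.isClosed ⟨x, hx⟩] at ha
  exact fun h => h ha

theorem exists_orderIso_eq {F : Set X} (hF : F ∈ pairRC X₀) : ∃ a, (e a).1.1 = F :=
  ⟨e.symm ⟨⟨F, pairRC_subset hd hF⟩, hF⟩, by rw [e.apply_symm_apply]⟩

theorem isUltrafilter_grillOfPoint {x : X} (hx : x ∈ X₀) : IsUltrafilter (grillOfPoint e x).1 :=
  (grillOfPoint e x).2.isUltrafilter fun _ ha => notMem_orderIso_compl e hx ha

theorem grillOfPoint_injective (h : IsStone2Space X X₀) :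
    Function.Injective (grillOfPoint e) := by
  intro x y hxy
  have := h.t0
  refine h.closedBase.eq_of_forall_mem_iff fun F hF => ?_
  obtain ⟨a, rfl⟩ := exists_orderIso_eq e hF
  rw [← mem_grillOfPoint, hxy, mem_grillOfPoint]

theorem grillOfPoint_surjective (h : IsStone2Space X X₀) :
    Function.Surjective (grillOfPoint e) := by
  intro Γ
  -- transport `Γ` to the algebra of clopen subsets of `X₀`
  have hΓ : IsGrill
      {F : Clopens X₀ | ∃ a ∈ Γ.1, (e a).1.1 = closure (Subtype.val '' (F : Set X₀))} := by
    have hcl (F : Clopens X₀) : ∃ a, (e a).1.1 = closure (Subtype.val '' (F : Set X₀)) :=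
      exists_orderIso_eq e ⟨F, F.isClopen, rfl⟩
    refine ⟨?_, ?_, ?_, ?_⟩
    · obtain ⟨a, ha⟩ := Γ.2.nonempty
      obtain ⟨D, hD, hDa⟩ := (e a).2
      exact ⟨⟨D, hD⟩, a, ha, hDa.symm⟩
    · rintro ⟨a, ha, hea⟩
      have : a ≤ ⊥ := by
        rw [← e.le_iff_le]
        change (e a).1.1 ⊆ _
        rw [hea, Clopens.coe_bot, Set.image_empty, closure_empty]
        exact Set.empty_subset _
      exact Γ.2.bot_notMem (le_bot_iff.mp this ▸ ha)
    · rintro F G ⟨a, ha, hea⟩ hFG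
      obtain ⟨b, hb⟩ := hcl G
      refine ⟨b, Γ.2.upward _ _ ha ?_, hb⟩
      rw [← e.le_iff_le]
      change (e a).1.1 ⊆ (e b).1.1
      rw [hea, hb]
      exact closure_mono (Set.image_mono hFG)
    · rintro F G ⟨a, ha, hea⟩
      obtain ⟨b, hb⟩ := hcl F
      obtain ⟨c, hc⟩ := hcl G
      have hle : a ≤ b ⊔ c := by
        rw [← e.le_iff_le]
        intro x hx
        rw [mem_orderIso_sup, hb, hc]
        rw [hea, Clopens.coe_sup, Set.image_union, closure_union] at hx
        exact hx
      exact (Γ.2.prime b c (Γ.2.upward _ _ ha hle)).imp (fun h => ⟨b, h, hb⟩) fun h => ⟨c, h, hc⟩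
  obtain ⟨x, hx⟩ := h.grill_eq _ hΓ
  refine ⟨x, Subtype.ext (Set.ext fun a => ?_)⟩
  obtain ⟨D, hD, hDa⟩ := (e a).2
  have hxD := Set.ext_iff.mp hx ⟨D, hD⟩
  change x ∈ (e a).1.1 ↔ _
  rw [← hDa]
  refine hxD.symm.trans ⟨?_, fun ha => ⟨a, ha, hDa.symm⟩⟩
  rintro ⟨b, hb, heb⟩
  have : b = a := e.injective (Subtype.ext (Subtype.ext (heb.trans hDa)))
  exact this ▸ hb

theorem isInducing_grillOfPoint (h : IsStone2Space X X₀) :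
    Topology.IsInducing (grillOfPoint e) := by
  refine ⟨?_⟩
  refine h.closedBase.eq_generateFrom.trans (Eq.trans ?_ induced_generateFrom_eq.symm)
  congr 1
  ext U
  constructor
  · rintro ⟨F, hF, rfl⟩
    obtain ⟨a, rfl⟩ := exists_orderIso_eq e hF
    exact ⟨_, ⟨a, rfl⟩, rfl⟩
  · rintro ⟨_, ⟨a, rfl⟩, rfl⟩
    exact ⟨_, (e a).2, rfl⟩

/-- The points of `X₀` are exactly those whose grill is an ultrafilter. If the grill of `x` is an
ultrafilter, its members have the finite intersection property on the compact space `X₀`, so it is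
contained in the grill of some `y ∈ X₀`, and maximality gives `x = y`. -/
theorem isUltrafilter_grillOfPoint_iff (h : IsStone2Space X X₀) {x : X} :
    IsUltrafilter (grillOfPoint e x).1 ↔ x ∈ X₀ := by
  refine ⟨fun hU => ?_, isUltrafilter_grillOfPoint e⟩
  have := h.compact_core
  let t : (grillOfPoint e x).1 → Set X₀ := fun a => Subtype.val ⁻¹' (e a.1).1.1
  have hcl (a) : IsClosed (t a) :=
    (isClosed_of_mem_regularClosedSets (e a.1).1.2).preimage continuous_subtype_val
  have : Nonempty (grillOfPoint e x).1 := (grillOfPoint e x).2.nonempty.to_subtype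
  have hdir : Directed (· ⊇ ·) t := by
    rintro ⟨a, ha⟩ ⟨b, hb⟩
    exact ⟨⟨a ⊓ b, hU.prop.inf_mem _ _ ha hb⟩, fun z hz => (e.monotone inf_le_left : _) hz,
      fun z hz => (e.monotone inf_le_right : _) hz⟩
  have hne (a) : (t a).Nonempty := by
    obtain ⟨D, hD, hDa⟩ := (e a.1).2
    have hx : x ∈ closure (Subtype.val '' D) := by rw [hDa]; exact a.2
    obtain ⟨_, z, hz, -⟩ := closure_nonempty_iff.mp ⟨x, hx⟩
    refine ⟨z, ?_⟩
    change z.1 ∈ (e a.1).1.1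
    rw [← hDa]
    exact subset_closure ⟨z, hz, rfl⟩
  obtain ⟨y, hy⟩ := IsCompact.nonempty_iInter_of_directed_nonempty_isCompact_isClosed t hdir hne
    (fun a => (hcl a).isCompact) hcl
  have hle : (grillOfPoint e x).1 ⊆ (grillOfPoint e y.1).1 :=
    fun a ha => Set.mem_iInter.mp hy ⟨a, ha⟩
  have hge := hU.le_of_ge (isUltrafilter_grillOfPoint e y.2).prop hle
  rw [grillOfPoint_injective e h (Subtype.ext (subset_antisymm hle hge))]
  exact y.2

/-- A Stone 2-space is isomorphic to the canonical Stone 2-space of any Boolean algebra that is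
isomorphic to `RC(X, X₀)`. -/
theorem IsStone2Space.exists_homeomorph_grills (h : IsStone2Space X X₀)
    (e : A ≃o pairAlgebra X₀ hd) :
    ∃ f : X ≃ₜ Grills A, f '' X₀ = Ult A := by
  refine ⟨(Equiv.ofBijective _ ⟨grillOfPoint_injective e h,
    grillOfPoint_surjective e h⟩).toHomeomorphOfIsInducing (isInducing_grillOfPoint e h), ?_⟩
  ext Γ
  obtain ⟨x, rfl⟩ := grillOfPoint_surjective e h Γ
  change _ ↔ IsUltrafilter _
  rw [isUltrafilter_grillOfPoint_iff e h]
  exact (grillOfPoint_injective e h).mem_set_image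

end Representation

/-! ### Functoriality of the algebra of a pair -/

section Functoriality

variable {X Y : Type*} [TopologicalSpace X] [TopologicalSpace Y]

theorem image_mem_pairRC (f : X ≃ₜ Y) {X₀ : Set X} {F : Set X} (hF : F ∈ pairRC X₀) :
    f '' F ∈ pairRC (f '' X₀) := by
  obtain ⟨A, hA, rfl⟩ := hF
  refine ⟨f.image X₀ '' A, ?_, ?_⟩
  · exact ⟨(f.image X₀).isClosed_image.mpr hA.1, (f.image X₀).isOpen_image.mpr hA.2⟩
  · rw [f.image_closure, Set.image_image, Set.image_image]
    rfl

theorem exists_orderIso_pairAlgebra (f : X ≃ₜ Y) {X₀ : Set X} {Y₀ : Set Y} (h : f '' X₀ = Y₀)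
    (hX : Dense X₀) (hY : Dense Y₀) : Nonempty (pairAlgebra X₀ hX ≃o pairAlgebra Y₀ hY) := by
  have hf {F : Set X} (hF : F ∈ pairRC X₀) : f '' F ∈ pairRC Y₀ := h ▸ image_mem_pairRC f hF
  have hg {F : Set Y} (hF : F ∈ pairRC Y₀) : f.symm '' F ∈ pairRC X₀ := by
    have := image_mem_pairRC f.symm hF
    rwa [← h, ← Set.image_comp, f.symm_comp_self, Set.image_id] at this
  exact ⟨{
    toFun := fun F => ⟨⟨f '' F.1.1, pairRC_subset hY (hf F.2)⟩, hf F.2⟩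
    invFun := fun F => ⟨⟨f.symm '' F.1.1, pairRC_subset hX (hg F.2)⟩, hg F.2⟩
    left_inv := fun F => Subtype.ext (Subtype.ext (f.symm_image_image _))
    right_inv := fun F => Subtype.ext (Subtype.ext (f.image_symm_image _))
    map_rel_iff' := Set.image_subset_image_iff f.injective }⟩

end Functoriality

/-! ### The correspondence of isomorphism classes -/

/-- The canonical Stone 2-space of a Boolean algebra as a bundled object. -/
def canonicalStone2Space (B : BoolAlg.{u}) : Stone2Space.{u} :=
  ⟨Grills B, Ult B, isStone2Space_grills B⟩

theorem canonicalStone2Space_rel {A B : BoolAlg.{u}} (h : boolAlgSetoid A B) :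
    stone2SpaceSetoid (canonicalStone2Space A) (canonicalStone2Space B) := by
  obtain ⟨f, hf⟩ := h
  obtain ⟨e⟩ := hf.exists_orderIso
  exact stone2SpaceSetoid.symm
    ((isStone2Space_grills B).exists_homeomorph_grills (e.trans (gOrderIso dense_Ult)))

theorem algebra_rel {S T : Stone2Space.{u}} (h : stone2SpaceSetoid S T) :
    boolAlgSetoid S.algebra T.algebra := by
  obtain ⟨f, hf⟩ := h
  obtain ⟨e⟩ := exists_orderIso_pairAlgebra f hf S.isStone2Space.dense T.isStone2Space.dense
  exact ⟨e, isBooleanIso_orderIso e⟩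

/-- The bijection between isomorphism classes of Boolean algebras and of Stone 2-spaces. -/
def stone2SpaceEquiv : Quotient boolAlgSetoid.{u} ≃ Quotient stone2SpaceSetoid.{u} where
  toFun := Quotient.map canonicalStone2Space fun _ _ => canonicalStone2Space_rel
  invFun := Quotient.map Stone2Space.algebra fun _ _ => algebra_rel
  left_inv := by
    rintro ⟨B⟩
    refine Quotient.sound (boolAlgSetoid.symm ?_)
    exact ⟨gOrderIso dense_Ult, isBooleanIso_orderIso (gOrderIso dense_Ult)⟩
  right_inv := by
    rintro ⟨S⟩
    refine Quotient.sound (stone2SpaceSetoid.symm ?_)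
    exact S.isStone2Space.exists_homeomorph_grills (OrderIso.refl _)

end ConnectedStone

theorem theorem8p1 :
    -- the canonical pair of every Boolean algebra is a Stone 2-space, and
    ∃ hcan : ∀ (B : Type u) [BooleanAlgebra B],
        ConnectedStone.IsStone2Space (ConnectedStone.Grills B) (ConnectedStone.Ult B),
      -- (a)
      (∀ (B : Type u) [BooleanAlgebra B],
        (∃ g : B → ConnectedStone.pairAlgebra (ConnectedStone.Ult B) (hcan B).dense,
          ConnectedStone.IsBooleanIso g ∧ ∀ a : B, (g a).1.1 = ConnectedStone.gMap a) ∧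
        (ConnectedStone.pairRC (ConnectedStone.Ult B) =
            ConnectedStone.regularClosedSets (ConnectedStone.Grills B) ↔
          ConnectedStone.IsCompleteAlg B)) ∧
      -- (b)
      ∃ Φ : Quotient ConnectedStone.boolAlgSetoid.{u} ≃
          Quotient ConnectedStone.stone2SpaceSetoid.{u},
        (∀ B : BoolAlg.{u},
          Φ (Quotient.mk _ B) =
            Quotient.mk _ ⟨ConnectedStone.Grills B, ConnectedStone.Ult B, hcan B⟩) ∧
        ∀ S : ConnectedStone.Stone2Space.{u},
          Φ.symm (Quotient.mk _ S) = Quotient.mk _ S.algebra := by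
  refine ⟨fun B _ => ConnectedStone.isStone2Space_grills B, fun B _ => ⟨?_, ?_⟩,
    ConnectedStone.stone2SpaceEquiv, fun _ => rfl, fun _ => rfl⟩
  · exact ⟨_, ConnectedStone.isBooleanIso_orderIso
      (ConnectedStone.gOrderIso (ConnectedStone.isStone2Space_grills B).dense),
      ConnectedStone.gOrderIso_val _⟩
  · exact ConnectedStone.pairRC_Ult_eq_regularClosedSets_iff B
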